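/- All graphs are finite and simple, $G \mathbin{\square} H$ is the Cartesian product, and $s(G)$ is the search number (edge-search number) of $G$: the least $k$ such that $k$ searchers can clear $G$. Initially no searcher is on $G$ and every edge is dirty. The actions are: place a searcher on a vertex; move a searcher along an edge $uv$ from $u$ to $v$; remove a searcher from a vertex. A move along $uv$ from $u$ to $v$ clears $uv$ if another searcher is located at $u$ at the start of the move, or if all edges incident with $u$ other than $uv$ are already clear. After each action a clear edge instantly becomes dirty again if it can be reached from a dirty edge through vertices that hold no searcher. $G$ is cleared once all its edges are clear. Let $G$ and $H$ be graphs with clique numbers $m$ and $n$, respectively; if $m$ and $n$ are both even, assume that $m \le n$. Then $$s(G \mathbin{\square} H) \;\ge\; \begin{cases} \frac{m}{2}\,n + \frac{m}{2} - 1 & \text{if } m \text{ is even},\\[2pt] \left\lceil \frac{m}{2} \right\rceil n - 1 & \text{if } m \text{ is odd}. \end{cases}$$ -/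

import Mathlib

open scoped SimpleGraph

namespace GraphSearch

variable {V : Type*}

/-- An edge `e` of `G` is dirty, given that the edges in `clear` would be clear and that exactly
the vertices in `guarded` hold a searcher: either `e` is not in `clear`, or the intruder gets to
`e` from a dirty edge through a common endpoint that holds no searcher. -/
inductive Dirty (G : SimpleGraph V) (guarded : Set V) (clear : Set (Sym2 V)) : Sym2 V → Prop
  | not_clear {e : Sym2 V} (he : e ∈ G.edgeSet) (hc : e ∉ clear) : Dirty G guarded clear e
  | spread {e f : Sym2 V} {w : V} (he : Dirty G guarded clear e) (hwe : w ∈ e)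
      (hf : f ∈ G.edgeSet) (hwf : w ∈ f) (hw : w ∉ guarded) : Dirty G guarded clear f

/-- A situation in a search with `k` searchers: the vertex at which each searcher is located
(`none` if the searcher is not on the graph), and the set of clear edges. -/
structure Situation (V : Type*) (k : ℕ) where
  pos : Fin k → Option V
  clear : Set (Sym2 V)

/-- The situation before the first action: no searcher is on the graph and no edge is clear. -/
def Situation.initial (V : Type*) (k : ℕ) : Situation V k where
  pos := fun _ => none
  clear := ∅

/-- The situation with searchers at `pos` that results, after instantaneous recontamination, from
the tentative set `clear` of clear edges. -/
def settle (G : SimpleGraph V) {k : ℕ} (pos : Fin k → Option V) (clear : Set (Sym2 V)) :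
    Situation V k where
  pos := pos
  clear := {e | e ∈ G.edgeSet ∧ ¬ Dirty G {v | ∃ i, pos i = some v} clear e}

/-- The traversal of the edge `uv` by searcher `i`, located at `u`, clears `uv`: another searcher
is located at `u` as well, or all other edges incident with `u` are already clear. -/
def Clears (G : SimpleGraph V) {k : ℕ} (σ : Situation V k) (i : Fin k) (u v : V) : Prop :=
  (∃ j, j ≠ i ∧ σ.pos j = some u) ∨ ∀ w, G.Adj u w → w ≠ v → s(u, w) ∈ σ.clear

/-- The three permitted actions. -/
inductive Action (G : SimpleGraph V) {k : ℕ} : Situation V k → Situation V k → Prop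
  | place (σ : Situation V k) (i : Fin k) (v : V) (hi : σ.pos i = none) :
      Action G σ (settle G (Function.update σ.pos i (some v)) σ.clear)
  | move (σ : Situation V k) (i : Fin k) (u v : V) (hi : σ.pos i = some u) (huv : G.Adj u v) :
      Action G σ (settle G (Function.update σ.pos i (some v))
        (σ.clear ∪ {e | e = s(u, v) ∧ Clears G σ i u v}))
  | remove (σ : Situation V k) (i : Fin k) (v : V) (hi : σ.pos i = some v) :
      Action G σ (settle G (Function.update σ.pos i none) σ.clear)

/-- There is a search strategy for `G` with `k` searchers: a finite sequence of actions after
which all edges are clear. -/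
def Searchable (G : SimpleGraph V) (k : ℕ) : Prop :=
  ∃ σ : Situation V k, Relation.ReflTransGen (Action G) (Situation.initial V k) σ ∧
    ∀ e ∈ G.edgeSet, e ∈ σ.clear

/-- The search number `s(G)`: the fewest searchers for which a search strategy exists. -/
noncomputable def searchNumber (G : SimpleGraph V) : ℕ :=
  sInf {k | Searchable G k}

end GraphSearch

/-! Call a vertex untouched if no clear edge meets it. Recontamination guards every touched vertex
that has an untouched neighbour, so the set `Y` of untouched vertices always has at most `k` outer
boundary vertices. An action removes at most two vertices from `Y`, and these can be removed one at
a time (`untouched_of_reachable`). Take maximum cliques `P`, `Q` and let `a`, `b` count the rows and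
columns of `P ×ˢ Q` that meet `Y`. A vertex of the grid outside `Y`, in a row or column that meets
`Y`, lies in the boundary; hence `|P||Q| ≤ |Y ∩ (P ×ˢ Q)| + k + (|P| - a)(|Q| - b)`. As `(a, b)`
descends from `(|P|, |Q|)` to `(0, 0)` by steps of at most one per coordinate, it must cross the
middle, and there this inequality bounds `k` from below (`Searchable.not_barrier`). -/

namespace GraphSearch

open Relation

/-! ### Untouched vertices during a search of an arbitrary graph -/

section General

variable {α : Type*} {Γ : SimpleGraph α} {k : ℕ}

/-- The vertices that hold a searcher. -/
def Situation.guarded (σ : Situation α k) : Set α := {v | ∃ i, σ.pos i = some v}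

/-- The vertices that are incident with no edge of `C`. -/
def untouched (C : Set (Sym2 α)) : Set α := {x | ∀ y, s(x, y) ∉ C}

/-- The vertices outside `Y` with a neighbour in `Y`. -/
def outerBoundary (Γ : SimpleGraph α) (Y : Set α) : Set α := {x | x ∉ Y ∧ ∃ y ∈ Y, Γ.Adj x y}

/-- A situation is settled if a vertex incident with both a clear and a dirty edge holds a
searcher. -/
def Situation.Settled (Γ : SimpleGraph α) (σ : Situation α k) : Prop :=
  ∀ e f w, e ∈ σ.clear → f ∈ Γ.edgeSet → f ∉ σ.clear → w ∈ e → w ∈ f → w ∈ σ.guarded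

theorem settled_settle (pos : Fin k → Option α) (C : Set (Sym2 α)) :
    (settle Γ pos C).Settled Γ := by
  rintro e f w ⟨he, hd⟩ hf hfc hwe hwf
  by_contra hw
  refine hfc ⟨hf, fun hdf => hd (Dirty.spread hdf hwf he hwe hw)⟩

theorem settle_clear_subset (pos : Fin k → Option α) (C : Set (Sym2 α)) :
    (settle Γ pos C).clear ⊆ C := by
  rintro e ⟨he, hd⟩
  by_contra hc
  exact hd (Dirty.not_clear he hc)

theorem settled_of_reachable {σ : Situation α k}
    (h : ReflTransGen (Action Γ) (Situation.initial α k) σ) : σ.Settled Γ := by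
  induction h with
  | refl => exact fun e f w he => he.elim
  | tail _ hstep _ => cases hstep <;> exact settled_settle _ _

theorem ncard_guarded_le (σ : Situation α k) : σ.guarded.ncard ≤ k := by
  have h : some '' σ.guarded ⊆ Set.range σ.pos := by
    rintro _ ⟨v, ⟨i, hi⟩, rfl⟩
    exact ⟨i, hi⟩
  rw [← Set.ncard_image_of_injective _ (Option.some_injective α)]
  calc _ ≤ (Set.range σ.pos).ncard := Set.ncard_le_ncard h (Set.finite_range _)
    _ = (σ.pos '' Set.univ).ncard := by rw [Set.image_univ]
    _ ≤ (Set.univ : Set (Fin k)).ncard := Set.ncard_image_le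
    _ = k := by simp [Set.ncard_univ]

theorem finite_guarded (σ : Situation α k) : σ.guarded.Finite := by
  refine Set.Finite.of_finite_image ((Set.finite_range σ.pos).subset ?_)
    (Option.some_injective α).injOn
  rintro _ ⟨v, ⟨i, hi⟩, rfl⟩
  exact ⟨i, hi⟩

theorem Situation.Settled.outerBoundary_subset {σ : Situation α k} (h : σ.Settled Γ) :
    outerBoundary Γ (untouched σ.clear) ⊆ σ.guarded := by
  rintro x ⟨hx, y, hy, hxy⟩
  simp only [untouched, Set.mem_ofPred_eq, not_forall, not_not] at hx
  obtain ⟨z, hz⟩ := hx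
  exact h _ s(x, y) x hz hxy (by rw [Sym2.eq_swap]; exact hy x) (by simp) (by simp)

/-- A property of the set of untouched vertices that holds for the set of all vertices, passes to
larger sets, and survives the loss of one vertex when the outer boundary has at most `k`
vertices, holds throughout a search with `k` searchers. -/
theorem untouched_of_reachable {p : Set α → Prop} (hmono : ∀ ⦃Y Z⦄, Y ⊆ Z → p Y → p Z)
    (huniv : p Set.univ)
    (hstep : ∀ Y v, p Y → (outerBoundary Γ Y).Finite → (outerBoundary Γ Y).ncard ≤ k →
      p (Y \ {v}))
    {σ : Situation α k} (h : ReflTransGen (Action Γ) (Situation.initial α k) σ) :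
    p (untouched σ.clear) := by
  induction h with
  | refl => exact hmono (fun x _ y hy => hy.elim) huniv
  | @tail σ τ hσ hact ih =>
    have hset := (settled_of_reachable hσ).outerBoundary_subset
    have hguard : ∀ Y v, p Y → outerBoundary Γ Y ⊆ σ.guarded → p (Y \ {v}) := fun Y v hY hb =>
      hstep Y v hY ((finite_guarded σ).subset hb)
        ((Set.ncard_le_ncard hb (finite_guarded σ)).trans (ncard_guarded_le σ))
    cases hact with
    | place i v hi =>
      exact hmono (fun x (hx : x ∈ untouched _) y hy => hx y (settle_clear_subset _ _ hy)) ih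
    | remove i v hi =>
      exact hmono (fun x (hx : x ∈ untouched _) y hy => hx y (settle_clear_subset _ _ hy)) ih
    | move i u v hi huv =>
      -- The move touches at most `u` and `v`. Deleting `u` first keeps the boundary guarded, since
      -- searcher `i` stands on `u`.
      have hu : outerBoundary Γ (untouched σ.clear \ {u}) ⊆ σ.guarded := by
        rintro x ⟨hx, y, hy, hxy⟩
        by_cases hxu : x = u
        · exact hxu ▸ ⟨i, hi⟩
        · exact hset ⟨fun h => hx ⟨h, hxu⟩, y, hy.1, hxy⟩
      refine hmono ?_ (hguard _ v (hguard _ u ih hset) hu)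
      rintro x ⟨⟨hx, hxu⟩, hxv⟩ y hy
      rcases settle_clear_subset _ _ hy with hy | ⟨hy, -⟩
      · exact hx y hy
      · rcases Sym2.eq_iff.1 hy with h | h
        · exact hxu h.1
        · exact hxv h.1

/-! ### Finite graphs are searchable -/

theorem clear_settle_of_forall_guarded {pos : Fin k → Option α} {C : Set (Sym2 α)}
    (hpos : ∀ v, ∃ i, pos i = some v) : (settle Γ pos C).clear = Γ.edgeSet ∩ C := by
  ext e
  refine ⟨fun he => ⟨he.1, settle_clear_subset _ _ he⟩, fun he => ⟨he.1, fun hd => ?_⟩⟩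
  cases hd with
  | not_clear _ hc => exact hc he.2
  | spread _ _ _ _ hw => exact hw (hpos _)

theorem exists_reachable_pos (l : Finset (Fin k)) (f : Fin k → α) :
    ∃ σ, ReflTransGen (Action Γ) (Situation.initial α k) σ ∧
      ∀ i, σ.pos i = if i ∈ l then some (f i) else none := by
  classical
  induction l using Finset.induction_on with
  | empty => exact ⟨_, .refl, fun i => by simp [Situation.initial]⟩
  | insert a l ha ih =>
    obtain ⟨σ, hσ, hpos⟩ := ih
    refine ⟨_, hσ.tail (Action.place σ a (f a) (by simp [hpos, ha])), fun i => ?_⟩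
    by_cases hi : i = a
    · subst hi; simp [settle]
    · simp [settle, hi, hpos]

/-- With a searcher on each vertex and one more, the edges can be cleared one by one. -/
theorem exists_searchable [Finite α] (Γ : SimpleGraph α) : ∃ k, Searchable Γ k := by
  classical
  have := Fintype.ofFinite α
  let N := Fintype.card α
  let g : Fin N ≃ α := (Fintype.equivFin α).symm
  let base : Fin (N + 1) → Option α := Fin.lastCases none (fun i => some (g i))
  have hbase : ∀ v, base (g.symm v).castSucc = some v := by simp [base]
  have hlast : base (Fin.last N) = none := by simp [base]
  have hupd : ∀ (x : Option α) v, ∃ i, Function.update base (Fin.last N) x i = some v :=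
    fun x v => ⟨(g.symm v).castSucc, by
      rw [Function.update_of_ne (Fin.castSucc_lt_last _).ne, hbase]⟩
  have key : ∀ F : Finset (Sym2 α), (F : Set (Sym2 α)) ⊆ Γ.edgeSet →
      ∃ σ, ReflTransGen (Action Γ) (Situation.initial α (N + 1)) σ ∧ σ.pos = base ∧
        (F : Set (Sym2 α)) ⊆ σ.clear := by
    intro F
    induction F using Finset.induction_on with
    | empty =>
      intro _
      rcases isEmpty_or_nonempty α with hα | ⟨⟨x₀⟩⟩
      · exact ⟨_, .refl, funext fun i => by
          rcases base i with _ | v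
          · rfl
          · exact hα.elim v, by simp⟩
      · obtain ⟨σ, hσ, hpos⟩ := exists_reachable_pos (Γ := Γ)
          -- `x₀` is a dummy: the last searcher is the spare one and is not placed.
          (Finset.univ.erase (Fin.last N)) (Fin.lastCases x₀ (fun i => g i))
        refine ⟨σ, hσ, funext fun i => ?_, by simp⟩
        rw [hpos]
        refine Fin.lastCases ?_ (fun i => ?_) i <;> simp [base]
    | insert e F he ih =>
      intro hF
      rw [Finset.coe_insert, Set.insert_subset_iff] at hF
      obtain ⟨σ, hσ, hpos, hcl⟩ := ih hF.2
      induction e with | h u v =>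
      have huv : Γ.Adj u v := hF.1
      let σ₁ := settle Γ (Function.update σ.pos (Fin.last N) (some u)) σ.clear
      have h₁ : Action Γ σ σ₁ := Action.place σ (Fin.last N) u (by rw [hpos, hlast])
      have c₁ : σ₁.clear = Γ.edgeSet ∩ σ.clear :=
        clear_settle_of_forall_guarded (by rw [hpos]; exact hupd _)
      have p₁ : σ₁.pos = Function.update base (Fin.last N) (some u) := by
        simp [σ₁, settle, hpos]
      have hC : Clears Γ σ₁ (Fin.last N) u v := Or.inl
        ⟨(g.symm u).castSucc, (Fin.castSucc_lt_last _).ne, by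
          rw [p₁, Function.update_of_ne (Fin.castSucc_lt_last _).ne, hbase]⟩
      let σ₂ := settle Γ (Function.update σ₁.pos (Fin.last N) (some v))
        (σ₁.clear ∪ {e | e = s(u, v) ∧ Clears Γ σ₁ (Fin.last N) u v})
      have h₂ : Action Γ σ₁ σ₂ := Action.move σ₁ (Fin.last N) u v (by simp [p₁]) huv
      have p₂ : σ₂.pos = Function.update base (Fin.last N) (some v) := by
        simp [σ₂, settle, p₁]
      have c₂ : σ₂.clear = _ :=
        clear_settle_of_forall_guarded (by rw [p₁, Function.update_idem]; exact hupd _)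
      have h₃ := Action.remove (G := Γ) σ₂ (Fin.last N) v (by simp [p₂])
      refine ⟨_, ((hσ.tail h₁).tail h₂).tail h₃, ?_, ?_⟩
      · simp [settle, p₂, ← hlast]
      · rw [clear_settle_of_forall_guarded (by rw [p₂, Function.update_idem]; exact hupd _), c₂,
          c₁, Finset.coe_insert, Set.insert_subset_iff]
        exact ⟨⟨huv, huv, Or.inr ⟨rfl, hC⟩⟩,
          fun e he => ⟨hF.2 he, hF.2 he, Or.inl ⟨hF.2 he, hcl he⟩⟩⟩
  obtain ⟨σ, hσ, -, hcl⟩ := key Γ.edgeSet.toFinite.toFinset (by simp)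
  exact ⟨N + 1, σ, hσ, fun e he => hcl (by simpa using he)⟩

end General

/-! ### Counting in a product of two cliques -/

section BoxProd

variable {V W : Type*} {G : SimpleGraph V} {H : SimpleGraph W} {P : Finset V} {Q : Finset W}
  {k : ℕ}

/-- Separation of the rows and columns of `P ×ˢ Q` that meet `Y` from those that do not. -/
theorem card_mul_card_le_of_outerBoundary [DecidableEq V] [DecidableEq W] (hP : G.IsClique P)
    (hQ : H.IsClique Q) {Y : Set (V × W)}
    (hfin : (outerBoundary (G □ H) Y).Finite) (hk : (outerBoundary (G □ H) Y).ncard ≤ k)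
    {Z : Finset (V × W)} (hZ : ∀ x, x ∈ Z ↔ x ∈ P ×ˢ Q ∧ x ∈ Y) :
    P.card * Q.card ≤ Z.card + k +
      (P.card - (Z.image Prod.fst).card) * (Q.card - (Z.image Prod.snd).card) := by
  have hfst : Z.image Prod.fst ⊆ P := by
    intro x hx
    obtain ⟨y, hy, rfl⟩ := Finset.mem_image.1 hx
    exact (Finset.mem_product.1 ((hZ y).1 hy).1).1
  have hsnd : Z.image Prod.snd ⊆ Q := by
    intro x hx
    obtain ⟨y, hy, rfl⟩ := Finset.mem_image.1 hx
    exact (Finset.mem_product.1 ((hZ y).1 hy).1).2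
  have hcover : P ×ˢ Q ⊆ Z ∪ hfin.toFinset ∪
      (P \ Z.image Prod.fst) ×ˢ (Q \ Z.image Prod.snd) := by
    rintro ⟨x, y⟩ hxy
    obtain ⟨hx, hy⟩ := Finset.mem_product.1 hxy
    by_cases hxyZ : (x, y) ∈ Z
    · simp [hxyZ]
    have hnot : (x, y) ∉ Y := fun h => hxyZ ((hZ _).2 ⟨hxy, h⟩)
    by_cases hrow : x ∈ Z.image Prod.fst
    · obtain ⟨⟨x', y'⟩, hz, rfl⟩ := Finset.mem_image.1 hrow
      obtain ⟨hz', hzY⟩ := (hZ _).1 hz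
      have hne : y ≠ y' := fun h => hnot (h ▸ hzY)
      refine Finset.mem_union_left _ (Finset.mem_union_right _ (hfin.mem_toFinset.2
        ⟨hnot, _, hzY, ?_⟩))
      exact SimpleGraph.boxProd_adj.2 (Or.inr ⟨hQ hy (Finset.mem_product.1 hz').2 hne, rfl⟩)
    by_cases hcol : y ∈ Z.image Prod.snd
    · obtain ⟨⟨x', y'⟩, hz, rfl⟩ := Finset.mem_image.1 hcol
      obtain ⟨hz', hzY⟩ := (hZ _).1 hz
      have hne : x ≠ x' := fun h => hnot (h ▸ hzY)
      refine Finset.mem_union_left _ (Finset.mem_union_right _ (hfin.mem_toFinset.2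
        ⟨hnot, _, hzY, ?_⟩))
      exact SimpleGraph.boxProd_adj.2 (Or.inl ⟨hP hx (Finset.mem_product.1 hz').1 hne, rfl⟩)
    · exact Finset.mem_union_right _ (Finset.mem_product.2
        ⟨Finset.mem_sdiff.2 ⟨hx, hrow⟩, Finset.mem_sdiff.2 ⟨hy, hcol⟩⟩)
  rw [Set.ncard_eq_toFinset_card _ hfin] at hk
  have h := (Finset.card_le_card hcover).trans (Finset.card_union_le _ _)
  have h' := Finset.card_union_le Z hfin.toFinset
  rw [Finset.card_product, Finset.card_product, Finset.card_sdiff_of_subset hfst,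
    Finset.card_sdiff_of_subset hsnd] at h
  lia

theorem card_image_le_card_image_erase_add_one {α β : Type*} [DecidableEq α] [DecidableEq β]
    (f : α → β) (Z : Finset α) (v : α) :
    (Z.image f).card ≤ ((Z.erase v).image f).card + 1 := by
  refine le_trans (Finset.card_le_card (t := insert (f v) ((Z.erase v).image f)) ?_)
    (Finset.card_insert_le _ _)
  intro y hy
  obtain ⟨x, hx, rfl⟩ := Finset.mem_image.1 hy
  by_cases h : x = v
  · simp [h]
  · exact Finset.mem_insert_of_mem (Finset.mem_image_of_mem f (Finset.mem_erase.2 ⟨h, hx⟩))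

/-- A property of the numbers `a` and `b` of rows and columns of a product of two cliques that
contain untouched vertices cannot be a barrier for a successful search. -/
theorem Searchable.not_barrier (hs : Searchable (G □ H) k) (hP : G.IsClique P)
    (hQ : H.IsClique Q) (hPQ : 2 ≤ P.card * Q.card) {p : ℕ → ℕ → Prop}
    (hmono : ∀ ⦃a a' b b'⦄, a ≤ a' → b ≤ b' → p a b → p a' b')
    (htop : p P.card Q.card) (hbot : ¬ p 0 0)
    (hstep : ∀ a a' b b', a' ≤ a → a ≤ a' + 1 → a ≤ P.card → b' ≤ b → b ≤ b' + 1 →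
      b ≤ Q.card → P.card * Q.card ≤ 1 + a' * b' + k + (P.card - a) * (Q.card - b) →
      p a b → p a' b') : False := by
  classical
  let Z : Set (V × W) → Finset (V × W) := fun Y => (P ×ˢ Q).filter (· ∈ Y)
  have hZ : ∀ Y x, x ∈ Z Y ↔ x ∈ P ×ˢ Q ∧ x ∈ Y := fun Y x => Finset.mem_filter
  have hfst : ∀ Y, ((Z Y).image Prod.fst).card ≤ P.card := fun Y =>
    Finset.card_le_card fun x hx => by
      obtain ⟨y, hy, rfl⟩ := Finset.mem_image.1 hx
      exact (Finset.mem_product.1 ((hZ Y y).1 hy).1).1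
  have hsnd : ∀ Y, ((Z Y).image Prod.snd).card ≤ Q.card := fun Y =>
    Finset.card_le_card fun x hx => by
      obtain ⟨y, hy, rfl⟩ := Finset.mem_image.1 hx
      exact (Finset.mem_product.1 ((hZ Y y).1 hy).1).2
  have hpos : 0 < P.card ∧ 0 < Q.card :=
    CanonicallyOrderedAdd.mul_pos.1 (by lia)
  obtain ⟨σ, hσ, hclear⟩ := hs
  have h : p ((Z (untouched σ.clear)).image Prod.fst).card
      ((Z (untouched σ.clear)).image Prod.snd).card := by
    refine untouched_of_reachable (Γ := G □ H)
      (p := fun Y => p ((Z Y).image Prod.fst).card ((Z Y).image Prod.snd).card)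
      (fun Y Y' h => ?_) ?_ (fun Y v hY hfin hk => ?_) hσ
    · have hsub : Z Y ⊆ Z Y' := fun x hx => (hZ _ _).2 ⟨((hZ _ _).1 hx).1, h ((hZ _ _).1 hx).2⟩
      exact hmono (Finset.card_le_card (Finset.image_subset_image hsub))
        (Finset.card_le_card (Finset.image_subset_image hsub))
    · have : Z Set.univ = P ×ˢ Q := by simp [Z]
      simp only [this]
      rwa [Finset.product_image_fst (Finset.card_pos.1 hpos.2),
        Finset.product_image_snd (Finset.card_pos.1 hpos.1)]
    · have herase : Z (Y \ {v}) = (Z Y).erase v := by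
        ext x
        simp only [hZ, Finset.mem_erase, Set.mem_sdiff, Set.mem_singleton_iff]
        tauto
      have hle := card_mul_card_le_of_outerBoundary hP hQ hfin hk (hZ Y)
      -- Rows and columns are counted after the loss of `v`, at the price of 1; the product of the
      -- counts before the loss would be too weak.
      have hcard : (Z Y).card ≤ 1 + ((Z (Y \ {v})).image Prod.fst).card *
          ((Z (Y \ {v})).image Prod.snd).card := by
        rw [herase, ← Finset.card_product]
        have h₁ : (Z Y).card - 1 ≤ ((Z Y).erase v).card := Finset.pred_card_le_card_erase
        have h₂ := Finset.card_le_card ((Z Y).erase v).subset_product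
        lia
      refine hstep _ _ _ _ ?_ ?_ (hfst Y) ?_ ?_ (hsnd Y) (by lia) hY
      · rw [herase]
        exact Finset.card_le_card (Finset.image_subset_image (Finset.erase_subset _ _))
      · rw [herase]
        exact card_image_le_card_image_erase_add_one _ _ _
      · rw [herase]
        exact Finset.card_le_card (Finset.image_subset_image (Finset.erase_subset _ _))
      · rw [herase]
        exact card_image_le_card_image_erase_add_one _ _ _
  have hempty : Z (untouched σ.clear) = ∅ := by
    refine Finset.eq_empty_of_forall_notMem fun ⟨x, y⟩ hxy => ?_
    obtain ⟨hxy, hu⟩ := (hZ _ _).1 hxy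
    obtain ⟨hx, hy⟩ := Finset.mem_product.1 hxy
    -- As `2 ≤ P.card * Q.card`, every vertex of the grid lies on an edge, so none stays untouched
    -- at the end.
    rcases lt_or_ge 1 P.card with h1 | h1
    · obtain ⟨x', hx', hne⟩ := Finset.exists_mem_ne h1 x
      exact hu (x', y) (hclear _ (SimpleGraph.boxProd_adj.2 (Or.inl ⟨hP hx hx' hne.symm, rfl⟩)))
    · have h2 : 1 < Q.card := by nlinarith
      obtain ⟨y', hy', hne⟩ := Finset.exists_mem_ne h2 y
      exact hu (x, y') (hclear _ (SimpleGraph.boxProd_adj.2 (Or.inr ⟨hQ hy hy' hne.symm, rfl⟩)))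
  rw [hempty] at h
  exact hbot (by simpa using h)

/-- When `a` falls from `c + 1` to `c`, the count gives `(2c + 1)|Q| ≤ 1 + c b' + k + c(|Q| - b)`,
and `b' ≤ b` cancels the dependence on the columns. -/
theorem Searchable.le_of_odd_left (hs : Searchable (G □ H) k) (hP : G.IsClique P)
    (hQ : H.IsClique Q) {c : ℕ} (hc : P.card = 2 * c + 1) : (c + 1) * Q.card ≤ k + 1 := by
  by_contra! hlt
  have hPQ : 2 ≤ P.card * Q.card := by rw [hc]; nlinarith
  refine hs.not_barrier hP hQ hPQ (p := fun a _ => c < a) (fun a a' _ _ h _ h' => h'.trans_le h)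
    (by lia) (by lia) fun a a' b b' h₁ h₂ h₃ h₄ h₅ h₆ hle ha => ?_
  by_contra! ha'
  obtain rfl : a' = c := by lia
  obtain rfl : a = a' + 1 := by lia
  obtain ⟨t, ht⟩ := Nat.exists_eq_add_of_le h₆
  rw [hc, ht, show 2 * a' + 1 - (a' + 1) = a' by lia, show b + t - b = t by lia] at hle
  rw [ht] at hlt
  nlinarith [Nat.mul_le_mul_left a' h₄]

theorem Searchable.le_of_odd_right (hs : Searchable (G □ H) k) (hP : G.IsClique P)
    (hQ : H.IsClique Q) {c : ℕ} (hc : Q.card = 2 * c + 1) : (c + 1) * P.card ≤ k + 1 := by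
  by_contra! hlt
  have hPQ : 2 ≤ P.card * Q.card := by rw [hc]; nlinarith
  refine hs.not_barrier hP hQ hPQ (p := fun _ b => c < b) (fun _ _ b b' _ h h' => h'.trans_le h)
    (by lia) (by lia) fun a a' b b' h₁ h₂ h₃ h₄ h₅ h₆ hle hb => ?_
  by_contra! hb'
  obtain rfl : b' = c := by lia
  obtain rfl : b = b' + 1 := by lia
  obtain ⟨t, ht⟩ := Nat.exists_eq_add_of_le h₃
  rw [hc, ht, show 2 * b' + 1 - (b' + 1) = b' by lia, show a + t - a = t by lia] at hle
  rw [ht] at hlt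
  nlinarith [Nat.mul_le_mul_left b' h₁]

/-- The barrier falls when `a ≤ c` and `b ≤ d` first hold together. The crossing yields `2cd + c + d
≤ k + 2` if both counts drop to the middle, `2cd + d ≤ k + 1` if only `a` does, and `2cd + c ≤ k +
1` if only `b` does; `c ≤ d` makes the last the weakest. -/
theorem Searchable.le_of_even (hs : Searchable (G □ H) k) (hP : G.IsClique P)
    (hQ : H.IsClique Q) {c d : ℕ} (hc : P.card = 2 * c) (hd : Q.card = 2 * d) (hcd : c ≤ d) :
    2 * c * d + c ≤ k + 1 := by
  by_contra! hlt
  have hc0 : 1 ≤ c := by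
    by_contra! h
    obtain rfl : c = 0 := by lia
    lia
  refine hs.not_barrier hP hQ (by rw [hc, hd]; nlinarith) (p := fun a b => c < a ∨ d < b)
    (fun a a' b b' h h' => by lia) (by lia) (by lia) fun a a' b b' h₁ h₂ h₃ h₄ h₅ h₆ hle hab => ?_
  by_contra! hab'
  obtain ⟨ha', hb'⟩ := hab'
  rw [hc] at h₃
  rw [hd] at h₆
  rw [hc, hd] at hle
  zify [h₃, h₆] at *
  rcases lt_or_ge (c : ℤ) a with ha | ha
  · obtain rfl : a' = c := by lia
    obtain ha : (a : ℤ) = a' + 1 := by lia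
    rw [ha] at hle
    rcases lt_or_ge (d : ℤ) b with hb | hb
    · obtain rfl : b' = d := by lia
      obtain hb : (b : ℤ) = b' + 1 := by lia
      rw [hb] at hle
      nlinarith
    · nlinarith
  · obtain rfl : b' = d := by lia
    obtain hb : (b : ℤ) = b' + 1 := by lia
    rw [hb] at hle
    nlinarith

end BoxProd

end GraphSearch

theorem mainTheorem4 {V W : Type*} [Finite V] [Finite W]
    (G : SimpleGraph V) (H : SimpleGraph W) (m n : ℕ)
    (hm : G.cliqueNum = m) (hn : H.cliqueNum = n)
    (hmn : Even m → Even n → m ≤ n) :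
    (Even m →
      (m : ℚ) / 2 * n + (m : ℚ) / 2 - 1 ≤ (GraphSearch.searchNumber (G □ H) : ℚ)) ∧
    (Odd m →
      ((⌈(m : ℚ) / 2⌉ : ℤ) : ℚ) * n - 1 ≤ (GraphSearch.searchNumber (G □ H) : ℚ)) := by
  -- The infimum of an empty set would be 0, so some strategy must be shown to exist.
  have hs : GraphSearch.Searchable (G □ H) (GraphSearch.searchNumber (G □ H)) :=
    Nat.sInf_mem (GraphSearch.exists_searchable (G □ H))
  obtain ⟨P, hP⟩ := G.exists_isNClique_cliqueNum
  obtain ⟨Q, hQ⟩ := H.exists_isNClique_cliqueNum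
  rw [hm] at hP
  rw [hn] at hQ
  constructor
  · rintro hme
    obtain ⟨c, rfl⟩ := hme.two_dvd
    rcases Nat.even_or_odd n with hne | ⟨d, rfl⟩
    · have hle := hmn hme hne
      obtain ⟨d, rfl⟩ := hne.two_dvd
      have h := hs.le_of_even hP.isClique hQ.isClique hP.card_eq hQ.card_eq (by lia)
      have h' : (2 * c * d + c : ℚ) ≤ GraphSearch.searchNumber (G □ H) + 1 := by exact_mod_cast h
      push_cast
      linarith
    -- For `m = 2c` and `n = 2d + 1`, the claimed `mn/2 + m/2` equals `(d + 1)m`, the odd bound with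
    -- the factors exchanged.
    · have h := hs.le_of_odd_right hP.isClique hQ.isClique hQ.card_eq
      rw [hP.card_eq] at h
      have h' : ((d + 1) * (2 * c) : ℚ) ≤ GraphSearch.searchNumber (G □ H) + 1 := by
        exact_mod_cast h
      push_cast
      linarith
  · rintro ⟨c, rfl⟩
    have h := hs.le_of_odd_left hP.isClique hQ.isClique hP.card_eq
    rw [hQ.card_eq] at h
    have h' : ((c + 1) * n : ℚ) ≤ GraphSearch.searchNumber (G □ H) + 1 := by exact_mod_cast h
    have hceil : ⌈((2 * c + 1 : ℕ) : ℚ) / 2⌉ = (c : ℤ) + 1 := by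
      rw [Int.ceil_eq_iff]
      push_cast
      constructor <;> linarith
    rw [hceil]
    push_cast
    linarith
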